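/- Let $\Sigma$ be a fixed finite alphabet. For $B\in\mathbb N$ let $[-B..B]^\Sigma$ be the set of vectors $v\in\mathbb Z^\Sigma$ all of whose coordinates are integers between $-B$ and $B$, and for $Z\subseteq\mathbb Z^\Sigma$ let $\mathbb N Z$ denote the additive submonoid of $\mathbb Z^\Sigma$ generated by $Z$, i.e. the set of all finite sums of elements of $Z$ (including $0$). There are constants $K,c\in\mathbb N$, depending only on $\Sigma$, such that for all $C,Y,n\in\mathbb N$ there is a number $B\in\mathbb N$ with $$B\le K\cdot\bigl((C+Y)^{n}\bigr)^{c}$$ for which the following holds. Let $I_1,I_2$ be finite index sets (not necessarily disjoint) with $|I_1\cup I_2|=n$, and for every $i\in I_1\cup I_2$ let $W_i\subseteq[-C..C]^\Sigma$ and $Z_i\subseteq[-Y..Y]^\Sigma$. Put $S_k=\bigcup_{i\in I_k}(W_i+\mathbb N Z_i)$ for $k=1,2$. Then $$S_1\subseteq S_2\iff S_1\cap[-B..B]^\Sigma\subseteq S_2\cap[-B..B]^\Sigma,$$ and $S_1$ and $S_2$ are disjoint if and only if $S_1\cap[-B..B]^\Sigma$ and $S_2\cap[-B..B]^\Sigma$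 are disjoint. -/

import Mathlib

open scoped Pointwise

/-- The integer window `[-B..B]^Alph`. -/
def intBox (Alph : Type*) (B : ℕ) : Set (Alph → ℤ) :=
  {v | ∀ a, v a ∈ Set.Icc (-(B : ℤ)) (B : ℤ)}

/-- The set `⋃ i ∈ I, (W i + ℕ Z i)`, where `ℕ Z` is the set of all finite sums of elements of `Z`,
that is, the additive monoid generated by `Z`. -/
def bundleUnion {Alph ι : Type*} (W Z : ι → Set (Alph → ℤ)) (I : Finset ι) :
    Set (Alph → ℤ) :=
  ⋃ i ∈ I, (W i + (AddSubmonoid.closure (Z i) : Set (Alph → ℤ)))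

/-! The proof is a descent on the ℓ¹-norm: a vector `x` outside the window that witnesses
non-inclusion or a common point is replaced by a shorter witness `x - E • r`.

The direction `r` comes from Dirichlet approximation (`exists_short_direction`): it is short, nearly
parallel to `x`, and every short functional positive at `r` is large at `x`. Let `x` lie in a piece
`W + ℕZ`. If `r` is in the cone of the periods that `x` uses often, a bounded multiple `D • r` is a
bounded combination of them and can be removed; otherwise a short functional separates `r` from them
and would be both large and bounded at `x` (`exists_dvd_forall_sub_mem`). The same dichotomy for the
cone of all periods shows that a piece containing `x - E • r` also contains `x`, for suitable `E`
(`exists_dvd_forall_mem_of_sub_mem`). One `E`, a common multiple of at most `n + 1` numbers `D`,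
serves all pieces. Each `D` is polynomially bounded in `Y`, whence a bound with exponent linear in
`n`.

Shortness of functionals and coefficients (`farkas_bounded`) again rests on
`exists_short_direction`, which bounds generators of the integer points of a cone. -/

theorem intBox_mono {ι : Type*} {A B : ℕ} (h : A ≤ B) : intBox ι A ⊆ intBox ι B := by
  intro v hv i
  have := hv i
  simp only [Set.mem_Icc] at this ⊢
  omega

theorem neg_mem_intBox {ι : Type*} {B : ℕ} {v : ι → ℤ} (h : v ∈ intBox ι B) :
    -v ∈ intBox ι B := by
  intro i
  have := h i
  simp only [Set.mem_Icc, Pi.neg_apply] at this ⊢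
  omega

theorem abs_le_of_mem_intBox {ι : Type*} {B : ℕ} {v : ι → ℤ} (h : v ∈ intBox ι B) (i : ι) :
    |v i| ≤ B :=
  abs_le.2 (h i)

theorem single_mem_intBox {ι : Type*} [DecidableEq ι] {B : ℕ} (hB : 1 ≤ B) (i : ι) :
    Pi.single i (1 : ℤ) ∈ intBox ι B := by
  intro j
  rcases eq_or_ne j i with rfl | h
  · simp; omega
  · simp [h]

theorem abs_dotProduct_le {ι : Type*} [Fintype ι] {m A B : ℕ} (hm : Fintype.card ι ≤ m)
    {u v : ι → ℤ} (hu : u ∈ intBox ι A) (hv : v ∈ intBox ι B) :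
    |dotProduct u v| ≤ m * A * B := by
  calc |dotProduct u v| ≤ ∑ i, |u i * v i| := Finset.abs_sum_le_sum_abs _ _
    _ ≤ ∑ _i : ι, (A * B : ℤ) := by
        refine Finset.sum_le_sum fun i _ => ?_
        rw [abs_mul]
        exact mul_le_mul (abs_le_of_mem_intBox hu i) (abs_le_of_mem_intBox hv i)
          (abs_nonneg _) (by positivity)
    _ = Fintype.card ι * (A * B : ℤ) := by simp
    _ ≤ m * (A * B : ℤ) := by gcongr
    _ = m * A * B := by ring

/-! ### Simultaneous approximation and short directions. -/

/-- The bound on the denominator in simultaneous approximation. -/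
def dirichletBound (m N : ℕ) : ℕ := (2 * m * N) ^ m

/-- Dirichlet's pigeonhole argument for the numbers `x i / L`, with denominators cleared. -/
theorem exists_simultaneous_approximation {ι : Type*} [Fintype ι] (k : ℕ) (hk : 1 ≤ k)
    (L : ℕ) (hL : 0 < L) (x : ι → ℤ) :
    ∃ (q : ℕ) (r : ι → ℤ), 1 ≤ q ∧ q ≤ k ^ Fintype.card ι ∧
      ∀ i, k * |q * x i - L * r i| < L := by
  classical
  -- `f q` records which of the `k` equal subintervals of `[0, 1)` contains the fractional part of
  -- each `q * x i / L`.
  let f : ℕ → (ι → ℤ) := fun q i => (k * ((q * x i) % L)) / L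
  have hL' : (0 : ℤ) < L := by exact_mod_cast hL
  have hmaps : ∀ q ∈ Finset.range (k ^ Fintype.card ι + 1),
      f q ∈ Fintype.piFinset (fun _ : ι => Finset.Ico (0 : ℤ) k) := by
    intro q _
    rw [Fintype.mem_piFinset]
    intro i
    rw [Finset.mem_Ico]
    have h1 := Int.emod_nonneg (q * x i) hL'.ne'
    have h2 := Int.emod_lt_of_pos (q * x i) hL'
    refine ⟨Int.ediv_nonneg (by positivity) hL'.le, Int.ediv_lt_of_lt_mul hL' ?_⟩
    exact mul_lt_mul_of_pos_left h2 (by exact_mod_cast hk)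
  have hcard : (Fintype.piFinset (fun _ : ι => Finset.Ico (0 : ℤ) k)).card <
      (Finset.range (k ^ Fintype.card ι + 1)).card := by
    simp [Fintype.card_piFinset]
  obtain ⟨a, ha, b, hb, hab, hfab⟩ :=
    Finset.exists_ne_map_eq_of_card_lt_of_maps_to hcard hmaps
  wlog hlt : a < b generalizing a b
  · exact this b hb a ha hab.symm hfab.symm (by omega)
  refine ⟨b - a, fun i => (b * x i) / L - (a * x i) / L, by omega, ?_, fun i => ?_⟩
  · simp only [Finset.mem_range] at hb; omega
  · have hi : (k * ((a * x i) % L)) / (L : ℤ) = (k * ((b * x i) % L)) / L := congrFun hfab i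
    have e : ((b - a : ℕ) : ℤ) * x i - L * ((b * x i) / L - (a * x i) / L) =
        (b * x i) % L - (a * x i) % L := by
      rw [Nat.cast_sub hlt.le]
      have h1 := Int.mul_ediv_add_emod (b * x i) L
      have h2 := Int.mul_ediv_add_emod (a * x i) L
      linear_combination h2 - h1
    rw [e, ← abs_of_nonneg (show (0 : ℤ) ≤ k by positivity), ← abs_mul, abs_lt]
    have h1 := Int.mul_ediv_add_emod (k * ((a * x i) % L)) L
    have h2 := Int.mul_ediv_add_emod (k * ((b * x i) % L)) L
    have h3 := Int.emod_nonneg (k * ((a * x i) % L)) hL'.ne'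
    have h4 := Int.emod_lt_of_pos (k * ((a * x i) % L)) hL'
    have h5 := Int.emod_nonneg (k * ((b * x i) % L)) hL'.ne'
    have h6 := Int.emod_lt_of_pos (k * ((b * x i) % L)) hL'
    rw [hi] at h1
    constructor <;> linarith

/-- A long integer vector `x` has a short integer direction `r` such that every short functional
positive at `r` is large at `x`. -/
theorem exists_short_direction {ι : Type*} [Fintype ι] {m N M : ℕ} (hm : Fintype.card ι ≤ m)
    (hN : 1 ≤ N) {x : ι → ℤ} (hx : x ∉ intBox ι (2 * dirichletBound m N * M)) :
    ∃ r : ι → ℤ, r ≠ 0 ∧ r ∈ intBox ι (dirichletBound m N) ∧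
      ∀ h ∈ intBox ι N, 0 < dotProduct h r → (M : ℤ) < dotProduct h x := by
  set Q := dirichletBound m N with hQ
  let L := Finset.univ.sup fun i => (x i).natAbs
  have hle : ∀ i, |x i| ≤ L := by
    intro i
    have : (x i).natAbs ≤ L := Finset.le_sup (f := fun i => (x i).natAbs) (Finset.mem_univ i)
    rw [Int.abs_eq_natAbs]
    exact_mod_cast this
  have hxi : ∃ i, (2 * Q * M : ℕ) < (x i).natAbs := by
    by_contra! hcon
    refine hx fun i => ?_
    have := hcon i
    rw [Set.mem_Icc]
    omega
  obtain ⟨i₀, hi₀⟩ := hxi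
  have : Nonempty ι := ⟨i₀⟩
  obtain ⟨i₁, -, hi₁⟩ := Finset.exists_mem_eq_sup Finset.univ Finset.univ_nonempty
    (fun i => (x i).natAbs)
  have hL₁ : |x i₁| = L := by
    have : L = (x i₁).natAbs := hi₁
    rw [Int.abs_eq_natAbs, this]
  have hLbig : 2 * Q * M < L :=
    lt_of_lt_of_le hi₀ (Finset.le_sup (f := fun i => (x i).natAbs) (Finset.mem_univ i₀))
  have hm1 : 1 ≤ m := le_trans Fintype.card_pos hm
  have hk : 1 ≤ 2 * m * N := by nlinarith [Nat.mul_le_mul hm1 hN]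
  obtain ⟨q, r, hq1, hqk, hr⟩ :=
    exists_simultaneous_approximation (2 * m * N) hk L (by omega) x
  have hqQ : q ≤ Q := hqk.trans (Nat.pow_le_pow_right hk hm)
  have hL0 : (0 : ℤ) < L := by exact_mod_cast (show 0 < L by omega)
  have hk' : (1 : ℤ) ≤ ((2 * m * N : ℕ) : ℤ) := by exact_mod_cast hk
  have hr' : ∀ i, |q * x i - L * r i| < L := fun i =>
    lt_of_le_of_lt (le_mul_of_one_le_left (abs_nonneg _) hk') (hr i)
  have hq1' : (1 : ℤ) ≤ q := by exact_mod_cast hq1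
  refine ⟨r, ?_, ?_, ?_⟩
  · rintro rfl
    have := hr' i₁
    simp only [Pi.zero_apply, mul_zero, sub_zero, abs_mul, hL₁, Nat.abs_cast] at this
    nlinarith
  · intro i
    rw [Set.mem_Icc, ← abs_le]
    have h1 : |(L : ℤ) * r i| < L * (q + 1) := by
      calc |(L : ℤ) * r i| = |q * x i - (q * x i - L * r i)| := by ring_nf
        _ ≤ |q * x i| + |q * x i - L * r i| := abs_sub _ _
        _ < q * L + L := by
          rw [abs_mul, Nat.abs_cast]
          have := hr' i
          have := mul_le_mul_of_nonneg_left (hle i) (by positivity : (0 : ℤ) ≤ q)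
          linarith
        _ = L * (q + 1) := by ring
    rw [abs_mul, Nat.abs_cast] at h1
    have h2 := lt_of_mul_lt_mul_left h1 hL0.le
    have : (q : ℤ) ≤ Q := by exact_mod_cast hqQ
    linarith
  · intro h hh hpos
    -- With `2 * m * N` subintervals the error at `h` is at most `L / 2`, while `L * dotProduct h r
    -- ≥ L`. So `q * dotProduct h x ≥ L / 2 > Q * M`, and `q ≤ Q`.
    have key : 2 * |dotProduct h (fun i => q * x i - L * r i)| ≤ L := by
      have hmN : (0 : ℤ) < m := by exact_mod_cast hm1
      refine le_of_mul_le_mul_left ?_ hmN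
      calc (m : ℤ) * (2 * |dotProduct h (fun i => q * x i - L * r i)|)
          ≤ m * (2 * ∑ i, |h i * (q * x i - L * r i)|) := by
            gcongr; exact Finset.abs_sum_le_sum_abs _ _
        _ = ∑ i, 2 * m * (|h i| * |q * x i - L * r i|) := by
            simp only [abs_mul, Finset.mul_sum]
            exact Finset.sum_congr rfl fun i _ => by ring
        _ ≤ ∑ _i : ι, (L : ℤ) := by
            refine Finset.sum_le_sum fun i _ => ?_
            have h1 := abs_le_of_mem_intBox hh i
            calc 2 * m * (|h i| * |q * x i - L * r i|)
                ≤ 2 * m * (N * |q * x i - L * r i|) := by gcongr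
              _ = ((2 * m * N : ℕ) : ℤ) * |q * x i - L * r i| := by push_cast; ring
              _ ≤ L := (hr i).le
        _ = Fintype.card ι * (L : ℤ) := by simp
        _ ≤ m * L := by gcongr
    have e : dotProduct h (fun i => q * x i - L * r i) =
        q * dotProduct h x - L * dotProduct h r := by
      simp only [dotProduct, Finset.mul_sum, ← Finset.sum_sub_distrib]
      exact Finset.sum_congr rfl fun i _ => by ring
    rw [e] at key
    have h1 := neg_abs_le (q * dotProduct h x - L * dotProduct h r)
    have h2 : (L : ℤ) ≤ L * dotProduct h r := le_mul_of_one_le_right hL0.le hpos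
    have h3 : (L : ℤ) ≤ 2 * (q * dotProduct h x) := by linarith
    have h4 : (2 * Q * M : ℤ) < L := by exact_mod_cast hLbig
    by_contra! hcon
    have hqQ' : (q : ℤ) ≤ Q := by exact_mod_cast hqQ
    have h5 : (q : ℤ) * dotProduct h x ≤ q * M := by gcongr
    have h6 : (q : ℤ) * M ≤ Q * M := by gcongr
    linarith

theorem sum_natAbs_sub_lt {ι : Type*} [Fintype ι] {x u : ι → ℤ} (hu : u ≠ 0)
    (hpos : ∀ i, 0 < u i → u i ≤ x i) (hneg : ∀ i, u i < 0 → x i ≤ u i) :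
    ∑ i, ((x - u) i).natAbs < ∑ i, (x i).natAbs := by
  obtain ⟨j, hj⟩ := Function.ne_iff.1 hu
  rw [Pi.zero_apply] at hj
  refine Finset.sum_lt_sum (fun i _ => ?_) ⟨j, Finset.mem_univ j, ?_⟩
  · have h1 := hpos i
    have h2 := hneg i
    rw [Pi.sub_apply]
    omega
  · have h1 := hpos j
    have h2 := hneg j
    rw [Pi.sub_apply]
    omega

/-! ### Short generators of the integer points of a cone. -/

/-- The size of generators of the monoid of integer points of a cone. -/
def hilbertBound (m N : ℕ) : ℕ :=
  2 * dirichletBound m N * (m * N * dirichletBound m N) + dirichletBound m N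

/-- The integer points of a cone cut out by short functionals are generated by short vectors. -/
theorem mem_closure_of_forall_dotProduct_nonneg {ι : Type*} [Fintype ι] {m N : ℕ}
    (hm : Fintype.card ι ≤ m) (hN : 1 ≤ N) {S : Set (ι → ℤ)} (hS : S ⊆ intBox ι N)
    {x : ι → ℤ} (hx : ∀ s ∈ S, 0 ≤ dotProduct s x) :
    x ∈ AddSubmonoid.closure
      {v | v ∈ intBox ι (hilbertBound m N) ∧ ∀ s ∈ S, 0 ≤ dotProduct s v} := by
  classical
  induction hk : ∑ i, (x i).natAbs using Nat.strong_induction_on generalizing x with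
  | _ k ih =>
    by_cases hbox : x ∈ intBox ι (2 * dirichletBound m N * (m * N * dirichletBound m N))
    · exact AddSubmonoid.subset_closure ⟨intBox_mono (Nat.le_add_right _ _) hbox, hx⟩
    obtain ⟨r, hr0, hrQ, hr⟩ := exists_short_direction hm hN hbox
    -- Applied to `±s`, this puts both `x - r` and `r` in the cone; applied to the coordinate
    -- functionals and their negatives, it makes `x - r` shorter than `x`.
    have hlt : ∀ h ∈ intBox ι N, 0 < dotProduct h r → dotProduct h r < dotProduct h x := by
      intro h hh hpos
      refine lt_of_le_of_lt ?_ (hr h hh hpos)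
      refine (le_abs_self _).trans ((abs_dotProduct_le hm hh hrQ).trans ?_)
      push_cast; rfl
    have hsub : ∀ s ∈ S, 0 ≤ dotProduct s (x - r) := by
      intro s hs
      rw [dotProduct_sub]
      rcases le_or_gt (dotProduct s r) 0 with h | h
      · linarith [hx s hs]
      · linarith [hlt s (hS hs) h]
    have hrS : ∀ s ∈ S, 0 ≤ dotProduct s r := by
      intro s hs
      by_contra! hneg
      have := hlt (-s) (neg_mem_intBox (hS hs)) (by rw [neg_dotProduct]; linarith)
      rw [neg_dotProduct, neg_dotProduct] at this
      linarith [hx s hs]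
    have hdrop : ∑ i, ((x - r) i).natAbs < k := by
      rw [← hk]
      refine sum_natAbs_sub_lt hr0 (fun i hi => ?_) (fun i hi => ?_)
      · simpa using (hlt _ (single_mem_intBox hN i) (by simpa using hi)).le
      · simpa using (hlt _ (neg_mem_intBox (single_mem_intBox hN i)) (by simpa using hi)).le
    have h1 := ih _ hdrop hsub rfl
    have h2 : r ∈ AddSubmonoid.closure
        {v | v ∈ intBox ι (hilbertBound m N) ∧ ∀ s ∈ S, 0 ≤ dotProduct s v} :=
      AddSubmonoid.subset_closure ⟨intBox_mono (Nat.le_add_left _ _) hrQ, hrS⟩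
    simpa using add_mem h1 h2

/-- A functional that is nonnegative on all short generators is nonnegative on the whole cone. This
turns any solution of a homogeneous system into a short one. -/
theorem exists_short_dotProduct_neg {ι : Type*} [Fintype ι] {m N : ℕ}
    (hm : Fintype.card ι ≤ m) (hN : 1 ≤ N) {S : Set (ι → ℤ)} (hS : S ⊆ intBox ι N)
    {x : ι → ℤ} (hx : ∀ s ∈ S, 0 ≤ dotProduct s x) {g : ι → ℤ} (hg : dotProduct g x < 0) :
    ∃ v ∈ intBox ι (hilbertBound m N), (∀ s ∈ S, 0 ≤ dotProduct s v) ∧ dotProduct g v < 0 := by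
  by_contra! hcon
  refine absurd hg (not_lt.2 ?_)
  refine AddSubmonoid.closure_induction (motive := fun y _ => 0 ≤ dotProduct g y) ?_ ?_ ?_
    (mem_closure_of_forall_dotProduct_nonneg hm hN hS hx)
  · exact fun v hv => hcon v hv.1 hv.2
  · simp
  · intro a b _ _ ha hb
    rw [dotProduct_add]
    exact add_nonneg ha hb

/-! ### Farkas' lemma and Carathéodory's theorem over the integers. -/

theorem farkas_seq {ι : Type*} [Fintype ι] (n : ℕ) (z : ℕ → ι → ℤ) (r : ι → ℤ) :
    (∃ D : ℕ, 0 < D ∧ D • r ∈ AddSubmonoid.closure (z '' Set.Iio n)) ∨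
      ∃ h : ι → ℤ, (∀ i < n, 0 ≤ dotProduct h (z i)) ∧ dotProduct h r < 0 := by
  induction n generalizing z r with
  | zero =>
    by_cases hr : r = 0
    · exact Or.inl ⟨1, one_pos, by simp [hr]⟩
    · refine Or.inr ⟨-r, by simp, ?_⟩
      rw [neg_dotProduct, neg_lt_zero]
      exact lt_of_le_of_ne (Finset.sum_nonneg fun i _ => mul_self_nonneg _)
        (fun h => hr (dotProduct_self_eq_zero.1 h.symm))
  | succ n ih =>
    have hmono : AddSubmonoid.closure (z '' Set.Iio n) ≤
        AddSubmonoid.closure (z '' Set.Iio (n + 1)) :=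
      AddSubmonoid.closure_mono (Set.image_mono (Set.Iio_subset_Iio n.le_succ))
    rcases ih z r with ⟨D, hD, hDr⟩ | ⟨f, hf, hfr⟩
    · exact Or.inl ⟨D, hD, hmono hDr⟩
    rcases le_or_gt 0 (dotProduct f (z n)) with hfa | hfa
    · refine Or.inr ⟨f, fun i hi => ?_, hfr⟩
      rcases Nat.lt_succ_iff_lt_or_eq.1 hi with h | rfl
      · exact hf i h
      · exact hfa
    obtain ⟨α, hα⟩ := Int.eq_ofNat_of_zero_le (show 0 ≤ -dotProduct f (z n) by linarith)
    obtain ⟨β, hβ⟩ := Int.eq_ofNat_of_zero_le (show 0 ≤ -dotProduct f r by linarith)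
    have hzn : z n ∈ AddSubmonoid.closure (z '' Set.Iio (n + 1)) :=
      AddSubmonoid.subset_closure ⟨n, by simp, rfl⟩
    -- Since `α = -dotProduct f (z n) > 0`, the map `v ↦ α • v + dotProduct f v • z n` is a scaled
    -- projection along `z n` onto the kernel of `f`. A functional `g` separating the projections
    -- pulls back to `α • g + dotProduct g (z n) • f`, which vanishes at `z n`.
    rcases ih (fun i => (α : ℤ) • z i + dotProduct f (z i) • z n)
        ((α : ℤ) • r + dotProduct f r • z n) with ⟨D, hD, hDr⟩ | ⟨g, hg, hgr⟩
    · refine Or.inl ⟨D * α, Nat.mul_pos hD (by omega), ?_⟩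
      have h1 : D • ((α : ℤ) • r + dotProduct f r • z n) ∈
          AddSubmonoid.closure (z '' Set.Iio (n + 1)) := by
        refine (AddSubmonoid.closure_le.2 ?_) hDr
        rintro _ ⟨i, hi, rfl⟩
        have hi' : i < n := hi
        obtain ⟨γ, hγ⟩ := Int.eq_ofNat_of_zero_le (hf i hi')
        simp only [hγ, natCast_zsmul]
        have hzi : z i ∈ AddSubmonoid.closure (z '' Set.Iio (n + 1)) :=
          AddSubmonoid.subset_closure ⟨i, Set.mem_Iio.2 (by omega), rfl⟩
        exact add_mem (nsmul_mem hzi _)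
          (nsmul_mem hzn _)
      have h2 := add_mem h1 (nsmul_mem hzn (D * β))
      convert h2 using 1
      have : dotProduct f r = -(β : ℤ) := by linarith
      rw [this]
      ext i
      simp
      ring
    · refine Or.inr ⟨(α : ℤ) • g + dotProduct g (z n) • f, fun i hi => ?_, ?_⟩
      · rcases Nat.lt_succ_iff_lt_or_eq.1 hi with h | rfl
        · have := hg i h
          simp only [dotProduct_add, dotProduct_smul, add_dotProduct, smul_dotProduct,
            smul_eq_mul] at this ⊢
          linarith
        · simp only [add_dotProduct, smul_dotProduct, smul_eq_mul]
          have : (α : ℤ) = -dotProduct f (z i) := hα.symm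
          rw [this]
          apply le_of_eq
          ring
      · simp only [dotProduct_add, dotProduct_smul, add_dotProduct, smul_dotProduct,
          smul_eq_mul] at hgr ⊢
        linarith

theorem farkas_int {ι : Type*} [Fintype ι] (Z : Finset (ι → ℤ)) (r : ι → ℤ) :
    (∃ D : ℕ, 0 < D ∧ D • r ∈ AddSubmonoid.closure (Z : Set (ι → ℤ))) ∨
      ∃ h : ι → ℤ, (∀ z ∈ Z, 0 ≤ dotProduct h z) ∧ dotProduct h r < 0 := by
  let z : ℕ → ι → ℤ := fun i => if h : i < Z.card then Z.equivFin.symm ⟨i, h⟩ else 0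
  have hz : z '' Set.Iio Z.card = Z := by
    ext v
    constructor
    · rintro ⟨i, hi, rfl⟩
      have hi' : i < Z.card := hi
      simp [z, hi']
    · intro hv
      refine ⟨Z.equivFin ⟨v, hv⟩, (Z.equivFin ⟨v, hv⟩).2, ?_⟩
      simp [z]
  rcases farkas_seq Z.card z r with h | ⟨h, hh, hr⟩
  · rw [hz] at h
    exact Or.inl h
  · refine Or.inr ⟨h, fun v hv => ?_, hr⟩
    obtain ⟨i, hi, rfl⟩ : v ∈ z '' Set.Iio Z.card := by rw [hz]; exact hv
    exact hh i hi

/-- Conic Carathéodory theorem over the integers. -/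
theorem exists_card_le_nsmul_mem_closure {ι : Type*} [Fintype ι] (Z : Finset (ι → ℤ))
    (r : ι → ℤ) {D : ℕ} (hD : 0 < D) (h : D • r ∈ AddSubmonoid.closure (Z : Set (ι → ℤ))) :
    ∃ T ⊆ Z, T.card ≤ Fintype.card ι ∧
      ∃ E : ℕ, 0 < E ∧ E • r ∈ AddSubmonoid.closure (T : Set (ι → ℤ)) := by
  classical
  induction hk : Z.card using Nat.strong_induction_on generalizing Z D with
  | _ k ih =>
    rcases le_or_gt Z.card (Fintype.card ι) with hc | hc
    · exact ⟨Z, subset_rfl, hc, D, hD, h⟩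
    obtain ⟨b, -, hb⟩ := AddSubmonoid.mem_closure_finset.1 h
    obtain ⟨c, hc0, hpos⟩ : ∃ c : (ι → ℤ) → ℤ, ∑ z ∈ Z, c z • z = 0 ∧ ∃ z ∈ Z, 0 < c z := by
      obtain ⟨c, hc0, z, hz, hcz⟩ := Module.exists_nontrivial_relation_of_finrank_lt_card
        (R := ℤ) (M := ι → ℤ) (t := Z) (by simpa using hc)
      rcases lt_or_gt_of_ne hcz with hneg | hpos
      · exact ⟨-c, by simp only [Pi.neg_apply, neg_smul, Finset.sum_neg_distrib, hc0, neg_zero], z, hz, by simpa using hneg⟩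
      · exact ⟨c, hc0, z, hz, hpos⟩
    -- The least ratio `b z / c z` is how far the relation `c` can be subtracted from `b` before a
    -- coefficient turns negative; there the coefficient of `z₀` vanishes.
    obtain ⟨z₀, hz₀, hmin⟩ := (Z.filter fun z => 0 < c z).exists_min_image
      (fun z => (b z : ℚ) / c z) (by
        obtain ⟨z, hz, hcz⟩ := hpos
        exact ⟨z, Finset.mem_filter.2 ⟨hz, hcz⟩⟩)
    obtain ⟨hz₀Z, hcz₀⟩ := Finset.mem_filter.1 hz₀
    have hnn : ∀ z ∈ Z, 0 ≤ c z₀ * b z - b z₀ * c z := by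
      intro z hz
      rcases le_or_gt (c z) 0 with hcz | hcz
      · have h1 : 0 ≤ c z₀ * b z := by positivity
        have h2 : (b z₀ : ℤ) * c z ≤ 0 := mul_nonpos_of_nonneg_of_nonpos (by positivity) hcz
        linarith
      · have := hmin z (Finset.mem_filter.2 ⟨hz, hcz⟩)
        rw [div_le_div_iff₀ (by exact_mod_cast hcz₀) (by exact_mod_cast hcz)] at this
        have h' : (b z₀ : ℤ) * c z ≤ b z * c z₀ := by exact_mod_cast this
        linarith
    have hmem : (D * (c z₀).toNat) • r ∈
        AddSubmonoid.closure ((Z.erase z₀ : Finset (ι → ℤ)) : Set (ι → ℤ)) := by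
      have e : (D * (c z₀).toNat) • r =
          ∑ z ∈ Z.erase z₀, (c z₀ * b z - b z₀ * c z).toNat • z := by
        have e1 : (D * (c z₀).toNat) • r = ∑ z ∈ Z, (c z₀ * b z - b z₀ * c z) • z := by
          have : ∑ z ∈ Z, (c z₀ * b z - b z₀ * c z) • z =
              c z₀ • ∑ z ∈ Z, b z • z - (b z₀ : ℤ) • ∑ z ∈ Z, c z • z := by
            simp only [Finset.smul_sum, ← Finset.sum_sub_distrib]
            refine Finset.sum_congr rfl fun z _ => ?_
            ext i
            simp
            ring
          rw [this, hb, hc0, smul_zero, sub_zero]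
          ext i
          have h3 : ((c z₀).toNat : ℤ) = c z₀ := Int.toNat_of_nonneg hcz₀.le
          simp [h3]
          ring
        rw [e1, ← Finset.add_sum_erase _ _ hz₀Z]
        rw [show c z₀ * b z₀ - b z₀ * c z₀ = 0 by ring, zero_smul, zero_add]
        refine Finset.sum_congr rfl fun z hz => ?_
        have h3 := Int.toNat_of_nonneg (hnn z (Finset.mem_of_mem_erase hz))
        rw [← natCast_zsmul, h3]
      rw [e]
      exact sum_mem fun z hz => nsmul_mem (AddSubmonoid.subset_closure hz) _
    obtain ⟨T, hT, hcard, hE⟩ := ih _ (by rw [← hk]; exact Finset.card_erase_lt_of_mem hz₀Z)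
      (Z.erase z₀) (Nat.mul_pos hD (by omega)) hmem rfl
    exact ⟨T, hT.trans (Finset.erase_subset _ _), hcard, hE⟩

/-- Farkas' lemma with bounds: a short separating functional, or short coefficients. -/
theorem farkas_bounded {ι : Type*} [Fintype ι] {m Y R : ℕ} (hm : Fintype.card ι ≤ m)
    (hY : 1 ≤ Y) {Z : Finset (ι → ℤ)} (hZ : (Z : Set (ι → ℤ)) ⊆ intBox ι Y)
    {r : ι → ℤ} (hr : r ∈ intBox ι R) :
    (∃ D : ℕ, 1 ≤ D ∧ D ≤ hilbertBound (m + 1) (Y + R) ∧ ∃ b : (ι → ℤ) → ℕ,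
      (∀ z, b z ≤ hilbertBound (m + 1) (Y + R)) ∧ D • r = ∑ z ∈ Z, b z • z) ∨
    ∃ h ∈ intBox ι (hilbertBound m Y), (∀ z ∈ Z, 0 ≤ dotProduct h z) ∧ dotProduct h r < 0 := by
  classical
  rcases farkas_int Z r with ⟨D, hD, hDr⟩ | ⟨h, hh, hhr⟩
  swap
  · right
    obtain ⟨v, hv, h1, h2⟩ := exists_short_dotProduct_neg hm hY hZ (x := h) (g := r)
      (fun z hz => by rw [dotProduct_comm]; exact hh z hz) (by rwa [dotProduct_comm])
    exact ⟨v, hv, fun z hz => by rw [dotProduct_comm]; exact h1 z hz, by rwa [dotProduct_comm]⟩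
  left
  -- Passing to at most `m` periods puts the unknown coefficients, together with the multiplier of
  -- `r`, in dimension at most `m + 1`, independent of `Z.card`.
  obtain ⟨T, hTZ, hTm, E, hE, hEr⟩ := exists_card_le_nsmul_mem_closure Z r hD hDr
  obtain ⟨b, -, hb⟩ := AddSubmonoid.mem_closure_finset.1 hEr
  let row : ι → Option T → ℤ := fun i o => o.elim (r i) fun z => -(z : ι → ℤ) i
  have hrow : ∀ i (v : Option T → ℤ), dotProduct (row i) v =
      r i * v none - ∑ z : T, (z : ι → ℤ) i * v (some z) := by
    intro i v
    simp [dotProduct, row, Fintype.sum_option, sub_eq_add_neg]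
  -- The cone of nonnegative solutions `(D, b)` of `D • r = ∑ b z • z`; the coordinate `none`
  -- carries `D`. Each equation is a pair of opposite inequalities.
  let S : Set (Option T → ℤ) :=
    (Set.range fun o => Pi.single o 1) ∪ (Set.range row ∪ Set.range fun i => -row i)
  have hrowbox : ∀ i, row i ∈ intBox (Option T) (Y + R) := by
    rintro i (_ | ⟨z, hz⟩)
    · exact intBox_mono (Nat.le_add_left _ _) hr i
    · exact intBox_mono (Nat.le_add_right _ _) (neg_mem_intBox (hZ (hTZ hz))) i
  have hS : S ⊆ intBox (Option T) (Y + R) := by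
    rintro _ (⟨o, rfl⟩ | ⟨i, rfl⟩ | ⟨i, rfl⟩)
    · exact single_mem_intBox (by omega) o
    · exact hrowbox i
    · exact neg_mem_intBox (hrowbox i)
  let x : Option T → ℤ := fun o => o.elim E fun z => b z
  have hx0 : ∀ i, dotProduct (row i) x = 0 := by
    intro i
    rw [hrow]
    have := congrFun hb i
    rw [Finset.sum_apply, ← Finset.sum_coe_sort] at this
    simp only [Pi.smul_apply, nsmul_eq_mul] at this
    simp only [x, Option.elim]
    simp only [mul_comm] at this ⊢
    linarith
  have hx : ∀ s ∈ S, 0 ≤ dotProduct s x := by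
    rintro _ (⟨o, rfl⟩ | ⟨i, rfl⟩ | ⟨i, rfl⟩)
    · rcases o with _ | z <;> simp [x]
    · rw [hx0]
    · simp [hx0]
  obtain ⟨v, hvbox, hvS, hvpos⟩ := exists_short_dotProduct_neg (m := m + 1) (by simp; omega)
    (by omega) hS hx (g := -Pi.single none 1) (by simp [x, hE])
  have hv0 : ∀ o, 0 ≤ v o := fun o => by
    simpa using hvS _ (Or.inl ⟨o, rfl⟩)
  have hvnone : 0 < v none := by simpa using hvpos
  have hvB : ∀ o, v o ≤ hilbertBound (m + 1) (Y + R) := fun o => (hvbox o).2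
  refine ⟨(v none).toNat, by omega, by have := hvB none; omega,
    fun z => if hz : z ∈ T then (v (some ⟨z, hz⟩)).toNat else 0, fun z => ?_, ?_⟩
  · dsimp only
    split_ifs with hz
    · have := hvB (some ⟨z, hz⟩); omega
    · exact Nat.zero_le _
  · ext i
    have h1 := hvS (row i) (Or.inr (Or.inl ⟨i, rfl⟩))
    have h2 := hvS (-row i) (Or.inr (Or.inr ⟨i, rfl⟩))
    rw [neg_dotProduct] at h2
    have h3 : dotProduct (row i) v = 0 := by linarith
    rw [hrow] at h3
    rw [← Finset.sum_subset hTZ (fun z _ hz => by simp [hz]), ← Finset.sum_coe_sort]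
    simp only [Finset.coe_mem, dif_pos, Finset.sum_apply, Pi.smul_apply, ← natCast_zsmul,
      smul_eq_mul, Int.toNat_of_nonneg hvnone.le, Int.toNat_of_nonneg (hv0 _)]
    simp only [mul_comm] at h3 ⊢
    linarith

theorem exists_finset_of_subset_intBox {ι : Type*} [Fintype ι] {Y : ℕ} {Z : Set (ι → ℤ)}
    (hZ : Z ⊆ intBox ι Y) :
    ∃ T : Finset (ι → ℤ), (T : Set (ι → ℤ)) = Z ∧ T.card ≤ (2 * Y + 1) ^ Fintype.card ι := by
  classical
  let F := Fintype.piFinset fun _ : ι => Finset.Icc (-(Y : ℤ)) Y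
  have hF : Z ⊆ F := by
    intro v hv
    simp only [F, Finset.mem_coe, Fintype.mem_piFinset, Finset.mem_Icc]
    exact fun i => hZ hv i
  have hfin : Z.Finite := F.finite_toSet.subset hF
  refine ⟨hfin.toFinset, hfin.coe_toFinset, ?_⟩
  calc hfin.toFinset.card ≤ F.card := Finset.card_le_card (by simpa using hF)
    _ = (2 * Y + 1) ^ Fintype.card ι := by
      have : ((Y : ℤ) + 1 + Y).toNat = 2 * Y + 1 := by omega
      simp [F, Fintype.card_piFinset, this]

/-! ### Moving along a short direction inside one piece. -/

/-- The size of separating functionals for periods in `intBox _ Y`. -/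
def functionalBound (m Y : ℕ) : ℕ := hilbertBound m (Y + 1) + 1

/-- The size of the directions along which long vectors are shortened. -/
def directionBound (m Y : ℕ) : ℕ := dirichletBound m (functionalBound m Y)

/-- The size of the coefficients that express a multiple of a direction by periods. -/
def coefficientBound (m Y : ℕ) : ℕ := hilbertBound (m + 1) (Y + 1 + directionBound m Y) + 1

/-- The value from which on a functional counts as large, when multiples up to `A` of a direction
are considered. -/
def heightBound (m C Y A : ℕ) : ℕ :=
  -- The summands bound, in turn, a functional on `W`, its total on the periods with small
  -- coefficients, its value on `E • r`, and the coordinates of `E • r`, for `E ≤ A`.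
  m * functionalBound m Y * C +
    (2 * Y + 1) ^ m * (A * coefficientBound m Y * (m * functionalBound m Y * Y)) +
    A * (m * functionalBound m Y * directionBound m Y) + A * directionBound m Y

section

variable {ι : Type*} [Fintype ι] {C Y A : ℕ} {x r : ι → ℤ} {W Z : Set (ι → ℤ)}

theorem exists_dvd_forall_sub_mem
    (hrQ : r ∈ intBox ι (directionBound (Fintype.card ι) Y))
    (hr : ∀ h ∈ intBox ι (functionalBound (Fintype.card ι) Y), 0 < dotProduct h r →
      (heightBound (Fintype.card ι) C Y A : ℤ) < dotProduct h x)
    (hW : W ⊆ intBox ι C) (hZ : Z ⊆ intBox ι Y)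
    (hx : x ∈ W + (AddSubmonoid.closure Z : Set (ι → ℤ))) :
    ∃ D : ℕ, 1 ≤ D ∧ D ≤ coefficientBound (Fintype.card ι) Y ∧ ∀ E, D ∣ E → E ≤ A →
      x - E • r ∈ W + (AddSubmonoid.closure Z : Set (ι → ℤ)) := by
  classical
  set m := Fintype.card ι with hm
  obtain ⟨T, rfl, hT⟩ := exists_finset_of_subset_intBox hZ
  obtain ⟨w, hw, y, hy, rfl⟩ := hx
  obtain ⟨a, -, rfl⟩ := AddSubmonoid.mem_closure_finset.1 hy
  -- The periods used often enough that removing `E • r` for `E ≤ A` leaves their coefficients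
  -- nonnegative.
  set T' := T.filter fun z => A * coefficientBound m Y ≤ a z with hT'
  have hT'T : T' ⊆ T := Finset.filter_subset _ _
  have hT'box : (T' : Set (ι → ℤ)) ⊆ intBox ι (Y + 1) := fun z hz =>
    intBox_mono (Nat.le_succ _) (hZ (hT'T hz))
  rcases farkas_bounded hm.ge (by omega) hT'box hrQ with ⟨D, hD1, hD, b, hb, hDr⟩ | ⟨h, hh, hhT, hhr⟩
  · refine ⟨D, hD1, hD.trans (Nat.le_succ _), ?_⟩
    rintro _ ⟨k, rfl⟩ hkA
    have hkb : ∀ z ∈ T', k * b z ≤ a z := by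
      intro z hz
      refine le_trans ?_ (Finset.mem_filter.1 hz).2
      have hk : k ≤ A := le_trans (Nat.le_mul_of_pos_left k hD1) hkA
      exact Nat.mul_le_mul hk ((hb z).trans (Nat.le_succ _))
    have e : w + ∑ z ∈ T, a z • z - (D * k) • r =
        w + ∑ z ∈ T, (a z - if z ∈ T' then k * b z else 0) • z := by
      have h1 : (D * k) • r = ∑ z ∈ T, (if z ∈ T' then k * b z else 0) • z := by
        rw [mul_comm, mul_smul, hDr, Finset.smul_sum, ← Finset.sum_subset hT'T]
        · exact Finset.sum_congr rfl fun z hz => by rw [if_pos hz, mul_smul]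
        · intro z _ hz
          rw [if_neg hz, zero_smul]
      rw [h1, add_sub_assoc, ← Finset.sum_sub_distrib]
      congr 1
      refine Finset.sum_congr rfl fun z _ => ?_
      split_ifs with hz
      · rw [sub_eq_iff_eq_add, ← add_smul, Nat.sub_add_cancel (hkb z hz)]
      · simp
    show w + ∑ z ∈ T, a z • z - (D * k) • r ∈ _
    rw [e]
    exact Set.add_mem_add hw (sum_mem fun z hz => nsmul_mem (AddSubmonoid.subset_closure hz) _)
  -- The functional `-h` is positive at `r`, hence large at `x`; but periods in `T'` contribute at
  -- most `0` to it, and the base vector and the other periods only a bounded amount.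
  · exfalso
    have hh' : h ∈ intBox ι (functionalBound m Y) := intBox_mono (Nat.le_succ _) hh
    have h1 := hr (-h) (neg_mem_intBox hh') (by rw [neg_dotProduct]; linarith)
    simp only [neg_dotProduct, dotProduct_add, dotProduct_sum, dotProduct_smul, smul_neg,
      Finset.sum_neg_distrib] at h1
    have h2 := neg_le_of_abs_le (abs_dotProduct_le hm.ge hh' (hW hw))
    have h3 : ∀ z ∈ T, -((A * coefficientBound m Y * (m * functionalBound m Y * Y) : ℕ) : ℤ) ≤
        a z • dotProduct h z := by
      intro z hz
      rw [nsmul_eq_mul]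
      by_cases hza : A * coefficientBound m Y ≤ a z
      · have h4 := hhT z (Finset.mem_filter.2 ⟨hz, hza⟩)
        exact le_trans (neg_nonpos.2 (Int.natCast_nonneg _)) (by positivity)
      · have h4 := abs_dotProduct_le hm.ge hh' (hZ hz)
        refine neg_le_of_abs_le ?_
        rw [abs_mul, Nat.abs_cast]
        push_cast
        have h5 : (a z : ℤ) ≤ A * coefficientBound m Y := by
          exact_mod_cast (not_le.1 hza).le
        gcongr
    have h4 := Finset.card_nsmul_le_sum T _ _ h3
    have h5 : ((T.card * (A * coefficientBound m Y * (m * functionalBound m Y * Y)) : ℕ) : ℤ) ≤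
        ((2 * Y + 1) ^ m * (A * coefficientBound m Y * (m * functionalBound m Y * Y)) : ℕ) := by
      exact_mod_cast Nat.mul_le_mul_right _ hT
    rw [heightBound] at h1
    rw [nsmul_eq_mul] at h4
    have h6 : (0 : ℤ) ≤ A * (m * functionalBound m Y * directionBound m Y) := by positivity
    have h7 : (0 : ℤ) ≤ A * directionBound m Y := by positivity
    push_cast at h1 h2 h4 h5
    linarith

theorem exists_dvd_forall_mem_of_sub_mem
    (hrQ : r ∈ intBox ι (directionBound (Fintype.card ι) Y))
    (hr : ∀ h ∈ intBox ι (functionalBound (Fintype.card ι) Y), 0 < dotProduct h r →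
      (heightBound (Fintype.card ι) C Y A : ℤ) < dotProduct h x)
    (hW : W ⊆ intBox ι C) (hZ : Z ⊆ intBox ι Y) :
    ∃ D : ℕ, 1 ≤ D ∧ D ≤ coefficientBound (Fintype.card ι) Y ∧ ∀ E, D ∣ E → E ≤ A →
      x - E • r ∈ W + (AddSubmonoid.closure Z : Set (ι → ℤ)) →
      x ∈ W + (AddSubmonoid.closure Z : Set (ι → ℤ)) := by
  classical
  set m := Fintype.card ι with hm
  obtain ⟨T, rfl, -⟩ := exists_finset_of_subset_intBox hZ
  have hTbox : (T : Set (ι → ℤ)) ⊆ intBox ι (Y + 1) := hZ.trans (intBox_mono (Nat.le_succ _))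
  rcases farkas_bounded hm.ge (by omega) hTbox hrQ with ⟨D, hD1, hD, b, hb, hDr⟩ | ⟨h, hh, hhT, hhr⟩
  · refine ⟨D, hD1, hD.trans (Nat.le_succ _), ?_⟩
    rintro _ ⟨k, rfl⟩ - ⟨w, hw, y, hy, hwy⟩
    have hDrmem : D • r ∈ AddSubmonoid.closure (T : Set (ι → ℤ)) := by
      rw [hDr]
      exact sum_mem fun z hz => nsmul_mem (AddSubmonoid.subset_closure hz) _
    refine ⟨w, hw, y + k • D • r, add_mem hy (nsmul_mem hDrmem k), ?_⟩
    have hwy' : w + y = x - (D * k) • r := hwy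
    show w + (y + k • D • r) = x
    rw [← add_assoc, hwy', smul_smul, mul_comm k D, sub_add_cancel]
  -- Here `x - E • r` cannot lie in the piece: `h` is bounded below on `W + ℕZ` and changes little
  -- along `E • r`, yet is very negative at `x`. So `D = 1` serves vacuously.
  · refine ⟨1, le_rfl, Nat.le_add_left _ _, ?_⟩
    rintro E - hEA ⟨w, hw, y, hy, hwy⟩
    exfalso
    have hwy' : w + y = x - E • r := hwy
    have hh' : h ∈ intBox ι (functionalBound m Y) := intBox_mono (Nat.le_succ _) hh
    have h1 := hr (-h) (neg_mem_intBox hh') (by rw [neg_dotProduct]; linarith)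
    have h2 := neg_le_of_abs_le (abs_dotProduct_le hm.ge hh' (hW hw))
    have h3 : 0 ≤ dotProduct h y := by
      refine AddSubmonoid.closure_induction (motive := fun y _ => 0 ≤ dotProduct h y)
        hhT (by simp) (fun a b _ _ ha hb => ?_) hy
      rw [dotProduct_add]
      exact add_nonneg ha hb
    have h4 := neg_le_of_abs_le (abs_dotProduct_le hm.ge hh' hrQ)
    have h5 : (E : ℤ) * (-dotProduct h r) ≤ A * (m * functionalBound m Y * directionBound m Y) := by
      have : (E : ℤ) ≤ A := by exact_mod_cast hEA
      have h4' : -dotProduct h r ≤ m * functionalBound m Y * directionBound m Y := by linarith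
      exact mul_le_mul this h4' (by linarith) (by positivity)
    have h6 := congrArg (dotProduct h) hwy'
    rw [dotProduct_add, dotProduct_sub, dotProduct_smul, nsmul_eq_mul] at h6
    rw [neg_dotProduct, heightBound] at h1
    have h7 : (0 : ℤ) ≤ A * directionBound m Y := by positivity
    have h8 : (0 : ℤ) ≤ (2 * Y + 1) ^ m *
      (A * coefficientBound m Y * (m * functionalBound m Y * Y)) := by positivity
    push_cast at h1 h2
    linarith

theorem sum_natAbs_sub_smul_lt (hr0 : r ≠ 0)
    (hrQ : r ∈ intBox ι (directionBound (Fintype.card ι) Y))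
    (hr : ∀ h ∈ intBox ι (functionalBound (Fintype.card ι) Y), 0 < dotProduct h r →
      (heightBound (Fintype.card ι) C Y A : ℤ) < dotProduct h x)
    {E : ℕ} (hE : 1 ≤ E) (hEA : E ≤ A) :
    ∑ i, ((x - E • r) i).natAbs < ∑ i, (x i).natAbs := by
  classical
  have hone : 1 ≤ functionalBound (Fintype.card ι) Y := Nat.le_add_left _ _
  have hE' : (0 : ℤ) < E := by exact_mod_cast hE
  have hbound : ∀ i, |(E • r) i| ≤ heightBound (Fintype.card ι) C Y A := by
    intro i
    have h1 := abs_le_of_mem_intBox hrQ i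
    have h2 : (E : ℤ) ≤ A := by exact_mod_cast hEA
    rw [Pi.smul_apply, nsmul_eq_mul, abs_mul, Nat.abs_cast]
    calc (E : ℤ) * |r i| ≤ A * directionBound (Fintype.card ι) Y := by gcongr
      _ ≤ heightBound (Fintype.card ι) C Y A := by
        exact_mod_cast Nat.le_add_left _ _
  refine sum_natAbs_sub_lt (smul_ne_zero (by omega) hr0) (fun i hi => ?_) (fun i hi => ?_)
  · have h0 : 0 < r i := by
      rw [Pi.smul_apply, nsmul_eq_mul] at hi
      exact pos_of_mul_pos_right hi hE'.le
    have := hr _ (single_mem_intBox hone i) (by simpa using h0)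
    rw [single_dotProduct, one_mul] at this
    exact (le_abs_self _).trans ((hbound i).trans this.le)
  · have h0 : r i < 0 := by
      rw [Pi.smul_apply, nsmul_eq_mul] at hi
      exact neg_of_mul_neg_right hi hE'.le
    have := hr _ (neg_mem_intBox (single_mem_intBox hone i)) (by simpa using h0)
    rw [neg_dotProduct, single_dotProduct, one_mul] at this
    have := neg_le_of_abs_le (hbound i)
    linarith

end

/-! ### Common multiples and the descent for unions. -/

theorem exists_common_multiple (p n : ℕ) (S : Finset ℕ) (hS : ∀ s ∈ S, 1 ≤ s ∧ s ≤ p)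
    (hn : S.card ≤ n) (hp : 1 ≤ p) :
    ∃ E, 1 ≤ E ∧ E ≤ min p.factorial (p ^ n) ∧ ∀ s ∈ S, s ∣ E := by
  have hprod : 0 < ∏ s ∈ S, s := Finset.prod_pos fun s hs => (hS s hs).1
  have h1 : S.lcm id ∣ p.factorial :=
    Finset.lcm_dvd fun s hs => Nat.dvd_factorial (hS s hs).1 (hS s hs).2
  have h2 : S.lcm id ∣ ∏ s ∈ S, s := Finset.lcm_dvd fun s hs => Finset.dvd_prod_of_mem _ hs
  refine ⟨S.lcm id, Nat.pos_of_dvd_of_pos h2 hprod, le_min ?_ ?_, fun s hs => Finset.dvd_lcm hs⟩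
  · exact Nat.le_of_dvd p.factorial_pos h1
  · calc S.lcm id ≤ ∏ s ∈ S, s := Nat.le_of_dvd hprod h2
      _ ≤ p ^ S.card := Finset.prod_le_pow_card _ _ _ fun s hs => (hS s hs).2
      _ ≤ p ^ n := Nat.pow_le_pow_right hp hn

/-- The bound on the common multiples of the periods of `n` pieces. -/
def multipleBound (m Y n : ℕ) : ℕ :=
  -- The factorial does not depend on `n`; it is needed when `C + Y = 1`, where the allowed bound `K
  -- * ((C + Y) ^ n) ^ c` is constant in `n`.
  min (coefficientBound m Y).factorial (coefficientBound m Y ^ n)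

/-- The window that decides inclusion and disjointness. -/
def windowBound (m C Y n : ℕ) : ℕ :=
  2 * directionBound m Y * heightBound m C Y (multipleBound m Y (n + 1))

theorem mem_bundleUnion {ι κ : Type*} {W Z : κ → Set (ι → ℤ)} {I : Finset κ} {x : ι → ℤ} :
    x ∈ bundleUnion W Z I ↔
      ∃ i ∈ I, x ∈ W i + (AddSubmonoid.closure (Z i) : Set (ι → ℤ)) := by
  simp [bundleUnion]

section

variable {ι κ : Type*} [Fintype ι] [DecidableEq κ] {C Y n : ℕ} {I₁ I₂ : Finset κ}
  {W Z : κ → Set (ι → ℤ)}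

/-- Below a long vector of `bundleUnion W Z I₁` there is a shorter one that is not in
`bundleUnion W Z I₂` unless the long vector is. -/
theorem exists_shorter_mem_of_mem (hn : (I₁ ∪ I₂).card = n)
    (hI : ∀ i ∈ I₁ ∪ I₂, W i ⊆ intBox ι C ∧ Z i ⊆ intBox ι Y)
    {x : ι → ℤ} (hx : x ∉ intBox ι (windowBound (Fintype.card ι) C Y n))
    (hx₁ : x ∈ bundleUnion W Z I₁) :
    ∃ y, ∑ i, (y i).natAbs < ∑ i, (x i).natAbs ∧ y ∈ bundleUnion W Z I₁ ∧
      (y ∈ bundleUnion W Z I₂ → x ∈ bundleUnion W Z I₂) := by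
  obtain ⟨r, hr0, hrQ, hr⟩ := exists_short_direction le_rfl
    (show 1 ≤ functionalBound (Fintype.card ι) Y from Nat.le_add_left _ _) hx
  obtain ⟨i, hi, hxi⟩ := mem_bundleUnion.1 hx₁
  have hi' := hI i (Finset.mem_union_left _ hi)
  obtain ⟨D₀, hD₀, hD₀p, hsub⟩ := exists_dvd_forall_sub_mem hrQ hr hi'.1 hi'.2 hxi
  choose! D hD hDp hadd using fun j (hj : j ∈ I₂) =>
    exists_dvd_forall_mem_of_sub_mem hrQ hr (hI j (Finset.mem_union_right _ hj)).1
      (hI j (Finset.mem_union_right _ hj)).2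
  -- One period for the piece of `I₁` containing `x` and one for each piece of `I₂`: at most `n + 1`
  -- in all.
  obtain ⟨E, hE1, hEA, hE⟩ := exists_common_multiple (coefficientBound (Fintype.card ι) Y) (n + 1)
    (insert D₀ (I₂.image D)) (by
      intro s hs
      rcases Finset.mem_insert.1 hs with rfl | hs
      · exact ⟨hD₀, hD₀p⟩
      · obtain ⟨j, hj, rfl⟩ := Finset.mem_image.1 hs
        exact ⟨hD j hj, hDp j hj⟩) (by
      refine (Finset.card_insert_le _ _).trans (Nat.succ_le_succ (Finset.card_image_le.trans ?_))
      rw [← hn]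
      exact Finset.card_le_card Finset.subset_union_right) (hD₀.trans hD₀p)
  refine ⟨x - E • r, sum_natAbs_sub_smul_lt hr0 hrQ hr hE1 hEA, ?_, fun hy => ?_⟩
  · exact mem_bundleUnion.2 ⟨i, hi, hsub E (hE _ (Finset.mem_insert_self _ _)) hEA⟩
  · obtain ⟨j, hj, hyj⟩ := mem_bundleUnion.1 hy
    exact mem_bundleUnion.2 ⟨j, hj, hadd j hj E
      (hE _ (Finset.mem_insert_of_mem (Finset.mem_image_of_mem _ hj))) hEA hyj⟩

/-- Below a long common vector of two unions there is a shorter one. -/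
theorem exists_shorter_common_mem (hn1 : 1 ≤ n)
    (hI : ∀ i ∈ I₁ ∪ I₂, W i ⊆ intBox ι C ∧ Z i ⊆ intBox ι Y)
    {x : ι → ℤ} (hx : x ∉ intBox ι (windowBound (Fintype.card ι) C Y n))
    (hx₁ : x ∈ bundleUnion W Z I₁) (hx₂ : x ∈ bundleUnion W Z I₂) :
    ∃ y, ∑ i, (y i).natAbs < ∑ i, (x i).natAbs ∧ y ∈ bundleUnion W Z I₁ ∧
      y ∈ bundleUnion W Z I₂ := by
  obtain ⟨r, hr0, hrQ, hr⟩ := exists_short_direction le_rfl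
    (show 1 ≤ functionalBound (Fintype.card ι) Y from Nat.le_add_left _ _) hx
  obtain ⟨i, hi, hxi⟩ := mem_bundleUnion.1 hx₁
  obtain ⟨j, hj, hxj⟩ := mem_bundleUnion.1 hx₂
  have hi' := hI i (Finset.mem_union_left _ hi)
  have hj' := hI j (Finset.mem_union_right _ hj)
  obtain ⟨D, hD, hDp, hDsub⟩ := exists_dvd_forall_sub_mem hrQ hr hi'.1 hi'.2 hxi
  obtain ⟨D', hD', hDp', hDsub'⟩ := exists_dvd_forall_sub_mem hrQ hr hj'.1 hj'.2 hxj
  obtain ⟨E, hE1, hEA, hE⟩ := exists_common_multiple (coefficientBound (Fintype.card ι) Y) (n + 1)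
    {D, D'} (by
      intro s hs
      rcases Finset.mem_insert.1 hs with rfl | hs
      · exact ⟨hD, hDp⟩
      · rw [Finset.mem_singleton.1 hs]
        exact ⟨hD', hDp'⟩) (Finset.card_le_two.trans (by omega)) (hD.trans hDp)
  refine ⟨x - E • r, sum_natAbs_sub_smul_lt hr0 hrQ hr hE1 hEA, ?_, ?_⟩
  · exact mem_bundleUnion.2 ⟨i, hi, hDsub E (hE _ (by simp)) hEA⟩
  · exact mem_bundleUnion.2 ⟨j, hj, hDsub' E (hE _ (by simp)) hEA⟩

theorem subset_of_inter_intBox_subset (hn : (I₁ ∪ I₂).card = n)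
    (hI : ∀ i ∈ I₁ ∪ I₂, W i ⊆ intBox ι C ∧ Z i ⊆ intBox ι Y)
    (h : bundleUnion W Z I₁ ∩ intBox ι (windowBound (Fintype.card ι) C Y n) ⊆
      bundleUnion W Z I₂) : bundleUnion W Z I₁ ⊆ bundleUnion W Z I₂ := by
  intro x hx
  induction hk : ∑ i, (x i).natAbs using Nat.strong_induction_on generalizing x with
  | _ k ih =>
    by_cases hbox : x ∈ intBox ι (windowBound (Fintype.card ι) C Y n)
    · exact h ⟨hx, hbox⟩
    obtain ⟨y, hlt, hy, hyx⟩ := exists_shorter_mem_of_mem hn hI hbox hx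
    exact hyx (ih _ (hk ▸ hlt) hy rfl)

theorem disjoint_of_disjoint_inter_intBox (hn1 : 1 ≤ n)
    (hI : ∀ i ∈ I₁ ∪ I₂, W i ⊆ intBox ι C ∧ Z i ⊆ intBox ι Y)
    (h : Disjoint (bundleUnion W Z I₁ ∩ intBox ι (windowBound (Fintype.card ι) C Y n))
      (bundleUnion W Z I₂ ∩ intBox ι (windowBound (Fintype.card ι) C Y n))) :
    Disjoint (bundleUnion W Z I₁) (bundleUnion W Z I₂) := by
  rw [Set.disjoint_left] at h ⊢
  intro x hx₁ hx₂
  induction hk : ∑ i, (x i).natAbs using Nat.strong_induction_on generalizing x with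
  | _ k ih =>
    by_cases hbox : x ∈ intBox ι (windowBound (Fintype.card ι) C Y n)
    · exact h ⟨hx₁, hbox⟩ ⟨hx₂, hbox⟩
    obtain ⟨y, hlt, hy₁, hy₂⟩ := exists_shorter_common_mem hn1 hI hbox hx₁ hx₂
    exact ih _ (hk ▸ hlt) hy₁ hy₂ rfl

end

/-! ### Growth of the window. -/

/-- Functions of polynomial growth. -/
def PolyBounded (f : ℕ → ℕ) : Prop := ∃ a c : ℕ, ∀ y, f y ≤ a * (y + 1) ^ c

namespace PolyBounded

theorem const (k : ℕ) : PolyBounded fun _ => k := ⟨k, 0, by simp⟩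

theorem self : PolyBounded fun y => y := ⟨1, 1, by simp⟩

theorem add {f g : ℕ → ℕ} (hf : PolyBounded f) (hg : PolyBounded g) :
    PolyBounded fun y => f y + g y := by
  obtain ⟨a, c, hf⟩ := hf
  obtain ⟨b, d, hg⟩ := hg
  refine ⟨a + b, c + d, fun y => ?_⟩
  calc f y + g y ≤ a * (y + 1) ^ c + b * (y + 1) ^ d := add_le_add (hf y) (hg y)
    _ ≤ a * (y + 1) ^ (c + d) + b * (y + 1) ^ (c + d) := by
      gcongr <;> omega
    _ = (a + b) * (y + 1) ^ (c + d) := by ring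

theorem mul {f g : ℕ → ℕ} (hf : PolyBounded f) (hg : PolyBounded g) :
    PolyBounded fun y => f y * g y := by
  obtain ⟨a, c, hf⟩ := hf
  obtain ⟨b, d, hg⟩ := hg
  refine ⟨a * b, c + d, fun y => (Nat.mul_le_mul (hf y) (hg y)).trans (le_of_eq ?_)⟩
  ring

theorem pow {f : ℕ → ℕ} (hf : PolyBounded f) (k : ℕ) : PolyBounded fun y => f y ^ k := by
  obtain ⟨a, c, hf⟩ := hf
  refine ⟨a ^ k, c * k, fun y => (Nat.pow_le_pow_left (hf y) k).trans (le_of_eq ?_)⟩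
  ring

theorem dirichletBound {f : ℕ → ℕ} (hf : PolyBounded f) (m : ℕ) :
    PolyBounded fun y => dirichletBound m (f y) :=
  ((const (2 * m)).mul hf).pow m

theorem hilbertBound {f : ℕ → ℕ} (hf : PolyBounded f) (m : ℕ) :
    PolyBounded fun y => hilbertBound m (f y) :=
  (((const 2).mul (hf.dirichletBound m)).mul
    (((const m).mul hf).mul (hf.dirichletBound m))).add (hf.dirichletBound m)

theorem functionalBound (m : ℕ) : PolyBounded (functionalBound m) :=
  ((self.add (const 1)).hilbertBound m).add (const 1)

theorem directionBound (m : ℕ) : PolyBounded (directionBound m) :=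
  (functionalBound m).dirichletBound m

theorem coefficientBound (m : ℕ) : PolyBounded (coefficientBound m) :=
  (((self.add (const 1)).add (directionBound m)).hilbertBound (m + 1)).add (const 1)

theorem exists_le_pow {f : ℕ → ℕ} (hf : PolyBounded f) :
    ∃ e : ℕ, ∀ t y, 2 ≤ t → y ≤ t → f y ≤ t ^ e := by
  obtain ⟨a, c, hf⟩ := hf
  refine ⟨a + 2 * c, fun t y ht hy => ?_⟩
  calc f y ≤ a * (y + 1) ^ c := hf y
    _ ≤ t ^ a * (t ^ 2) ^ c := by
      refine Nat.mul_le_mul ?_ (Nat.pow_le_pow_left (by nlinarith) c)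
      exact Nat.lt_two_pow_self.le.trans (Nat.pow_le_pow_left ht a)
    _ = t ^ (a + 2 * c) := by ring

end PolyBounded

/-- Isolates the common multiple, the only factor that depends on `n`; the rest is linear in `C` and
polynomial in `Y`. -/
theorem exists_windowBound_le (m : ℕ) :
    ∃ G : ℕ → ℕ, PolyBounded G ∧
      ∀ C Y n, windowBound m C Y n ≤ multipleBound m Y (n + 1) * ((C + 1) * G Y) := by
  refine ⟨fun Y => 2 * directionBound m Y * (m * functionalBound m Y +
      (2 * Y + 1) ^ m * (coefficientBound m Y * (m * functionalBound m Y * Y)) +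
      m * functionalBound m Y * directionBound m Y + directionBound m Y), ?_, fun C Y n => ?_⟩
  · have hF := (PolyBounded.const m).mul (PolyBounded.functionalBound m)
    have hD := PolyBounded.directionBound m
    have hC := PolyBounded.coefficientBound m
    have hpow := (((PolyBounded.const 2).mul .self).add (.const 1)).pow m
    exact ((PolyBounded.const 2).mul hD).mul
      (((hF.add (hpow.mul (hC.mul (hF.mul .self)))).add (hF.mul hD)).add hD)
  · have hA : 1 ≤ multipleBound m Y (n + 1) :=
      le_min (Nat.factorial_pos _) (Nat.pow_pos (Nat.succ_pos _))
    rw [windowBound, heightBound]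
    beta_reduce
    generalize multipleBound m Y (n + 1) = A at hA ⊢
    generalize directionBound m Y = q
    generalize m * functionalBound m Y = f
    generalize coefficientBound m Y = k
    generalize (2 * Y + 1) ^ m = s
    have h1 : f * C ≤ A * (C + 1) * f := by
      calc f * C = 1 * C * f := by ring
        _ ≤ A * (C + 1) * f := by gcongr; omega
    have h2 : ∀ u, A * u ≤ A * (C + 1) * u := fun u => by
      calc A * u = A * 1 * u := by ring
        _ ≤ A * (C + 1) * u := by gcongr; omega
    calc 2 * q * (f * C + s * (A * k * (f * Y)) + A * (f * q) + A * q)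
        = 2 * q * (f * C + A * (s * (k * (f * Y))) + A * (f * q) + A * q) := by ring
      _ ≤ 2 * q * (A * (C + 1) * f + A * (C + 1) * (s * (k * (f * Y))) +
            A * (C + 1) * (f * q) + A * (C + 1) * q) := by
          exact Nat.mul_le_mul_left _ (add_le_add (add_le_add (add_le_add h1 (h2 _)) (h2 _)) (h2 _))
      _ = A * ((C + 1) * (2 * q * (f + s * (k * (f * Y)) + f * q + q))) := by ring

theorem exists_windowBound_le_pow (m : ℕ) :
    ∃ K c : ℕ, ∀ C Y n, 1 ≤ C + Y → 1 ≤ n →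
      windowBound m C Y n ≤ K * ((C + Y) ^ n) ^ c := by
  obtain ⟨G, hG, hle⟩ := exists_windowBound_le m
  obtain ⟨e, he⟩ := (PolyBounded.coefficientBound m).exists_le_pow
  obtain ⟨g, hg⟩ := hG.exists_le_pow
  -- Bounds the window when `C + Y = 1`: then `C + 1 ≤ 2`, and `Y` is `0` or `1`.
  let u : ℕ → ℕ := fun Y => (coefficientBound m Y).factorial * (2 * G Y)
  refine ⟨u 0 + u 1 + 1, 2 * e + (2 + g), fun C Y n ht hn => (hle C Y n).trans ?_⟩
  rcases Nat.lt_or_ge 1 (C + Y) with h2 | h1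
  · have hpow : 1 ≤ (C + Y) ^ n := Nat.pow_pos ht
    have hY : Y ≤ C + Y := Nat.le_add_left _ _
    have hA : multipleBound m Y (n + 1) ≤ ((C + Y) ^ n) ^ (2 * e) := by
      calc multipleBound m Y (n + 1) ≤ coefficientBound m Y ^ (n + 1) := min_le_right _ _
        _ ≤ ((C + Y) ^ e) ^ (2 * n) :=
          (Nat.pow_le_pow_left (he _ _ h2 hY) _).trans
            (Nat.pow_le_pow_right (Nat.pow_pos ht) (by omega))
        _ = ((C + Y) ^ n) ^ (2 * e) := by ring
    have hB : (C + 1) * G Y ≤ ((C + Y) ^ n) ^ (2 + g) := by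
      calc (C + 1) * G Y ≤ (C + Y) ^ 2 * (C + Y) ^ g :=
            Nat.mul_le_mul (by nlinarith) (hg _ _ h2 hY)
        _ = (C + Y) ^ (2 + g) := by ring
        _ ≤ ((C + Y) ^ n) ^ (2 + g) :=
          Nat.pow_le_pow_left (Nat.le_self_pow (by omega) _) _
    calc multipleBound m Y (n + 1) * ((C + 1) * G Y)
        ≤ ((C + Y) ^ n) ^ (2 * e) * ((C + Y) ^ n) ^ (2 + g) := Nat.mul_le_mul hA hB
      _ = 1 * ((C + Y) ^ n) ^ (2 * e + (2 + g)) := by ring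
      _ ≤ _ := by gcongr; omega
  · have hone : C + Y = 1 := le_antisymm h1 ht
    rw [hone, one_pow, one_pow, mul_one]
    have hY : u Y ≤ u 0 + u 1 := by
      rcases (show Y = 0 ∨ Y = 1 by omega) with rfl | rfl <;> omega
    calc multipleBound m Y (n + 1) * ((C + 1) * G Y) ≤ u Y := by
          refine Nat.mul_le_mul (min_le_left _ _) (Nat.mul_le_mul_right _ (by omega))
      _ ≤ u 0 + u 1 + 1 := by omega

theorem bundleUnion_subset_intBox_zero {ι κ : Type*} {W Z : κ → Set (ι → ℤ)} {I : Finset κ}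
    (hI : ∀ i ∈ I, W i ⊆ intBox ι 0 ∧ Z i ⊆ intBox ι 0) :
    bundleUnion W Z I ⊆ intBox ι 0 := by
  have hzero : ∀ v ∈ intBox ι 0, v = 0 := by
    intro v hv
    ext i
    have := hv i
    simp only [Set.mem_Icc] at this
    rw [Pi.zero_apply]
    omega
  intro x hx
  obtain ⟨i, hi, w, hw, y, hy, rfl⟩ := mem_bundleUnion.1 hx
  have hy0 : y = 0 := by
    refine AddSubmonoid.mem_bot.1 ((AddSubmonoid.closure_le.2 ?_) hy)
    exact fun z hz => AddSubmonoid.mem_bot.2 (hzero z ((hI i hi).2 hz))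
  have hw' := (hI i hi).1 hw
  show w + y ∈ _
  rwa [hy0, add_zero]

theorem lemma3p1 (Alph : Type*) [Finite Alph] :
    ∃ K c : ℕ, ∀ C Y n : ℕ, ∃ B : ℕ, B ≤ K * ((C + Y) ^ n) ^ c ∧
      ∀ (ι : Type*) [DecidableEq ι] (I₁ I₂ : Finset ι) (W Z : ι → Set (Alph → ℤ)),
        (I₁ ∪ I₂).card = n →
        (∀ i ∈ I₁ ∪ I₂, W i ⊆ intBox Alph C ∧ Z i ⊆ intBox Alph Y) →
        (bundleUnion W Z I₁ ⊆ bundleUnion W Z I₂ ↔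
          bundleUnion W Z I₁ ∩ intBox Alph B ⊆ bundleUnion W Z I₂ ∩ intBox Alph B) ∧
        (Disjoint (bundleUnion W Z I₁) (bundleUnion W Z I₂) ↔
          Disjoint (bundleUnion W Z I₁ ∩ intBox Alph B)
            (bundleUnion W Z I₂ ∩ intBox Alph B)) := by
  have := Fintype.ofFinite Alph
  obtain ⟨K, c, hK⟩ := exists_windowBound_le_pow (Fintype.card Alph)
  refine ⟨K, c, fun C Y n => ?_⟩
  by_cases hCY : 1 ≤ C + Y ∧ 1 ≤ n
  · refine ⟨windowBound (Fintype.card Alph) C Y n, hK C Y n hCY.1 hCY.2, ?_⟩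
    intro ι _ I₁ I₂ W Z hn hI
    refine ⟨⟨fun h => Set.inter_subset_inter_left _ h, fun h => ?_⟩,
      ⟨fun h => h.mono Set.inter_subset_left Set.inter_subset_left, fun h => ?_⟩⟩
    · exact subset_of_inter_intBox_subset hn hI (h.trans Set.inter_subset_left)
    · exact disjoint_of_disjoint_inter_intBox hCY.2 hI h
  -- Either `n = 0` and both unions are empty, or `C = Y = 0` and both lie in `{0}`; the window `0`
  -- loses nothing.
  · refine ⟨0, Nat.zero_le _, ?_⟩
    intro ι _ I₁ I₂ W Z hn hI
    have hsub : ∀ I ⊆ I₁ ∪ I₂, bundleUnion W Z I ⊆ intBox Alph 0 := by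
      intro I hIsub
      refine bundleUnion_subset_intBox_zero fun i hi => ?_
      have hi' := hIsub hi
      have hn1 : 1 ≤ n := hn ▸ Finset.card_pos.2 ⟨i, hi'⟩
      obtain ⟨rfl, rfl⟩ : C = 0 ∧ Y = 0 := by omega
      exact hI i hi'
    rw [Set.inter_eq_left.2 (hsub _ Finset.subset_union_left),
      Set.inter_eq_left.2 (hsub _ Finset.subset_union_right)]
    exact ⟨Iff.rfl, Iff.rfl⟩
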